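/- Let $0<\alpha<2$ and let $\{X_t\}_{t\ge 0}$ be a self-similar Lévy process of stability index $\alpha$ on a probability space $(\Omega,\mathcal F,\mathbb P)$; that is, $X$ is a real-valued process with $X_0=0$ a.s. and with stationary and independent increments, and there are $\sigma>0$ and $\gamma\in\mathbb R$ (with $-1\le\gamma\le 1$ if $\alpha\ne 1$) such that $\mathbb E[e^{ikX_t}]=e^{-t\psi(k)}$ for all $t\ge 0$ and $k\in\mathbb R$, where $\psi(k)=\sigma^\alpha|k|^\alpha\bigl[1-i\gamma\tan(\pi\alpha/2)\,\mathrm{sgn}(k)\bigr]$ if $\alpha\ne 1$ and $\psi(k)=\sigma|k|-i\gamma k$ if $\alpha=1$. Write $\Delta_t^sX:=X_{t+s}-X_t$. Then for every real $q\ge\alpha$ and every integer $\tau\ge 1$, $$\lim_{N\to\infty}\frac{\sum_{n=0}^{N-1}\bigl|\Delta_{\tau n}^{\tau}X\bigr|^q}{\sum_{n=0}^{N-1}\sum_{i=0}^{\tau-1}\bigl|\Delta_{\tau n+i}^{1}X\bigr|^q}=1\qquad\text{almost surely.}$$ -/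

import Mathlib

open MeasureTheory ProbabilityTheory Filter Topology
open scoped NNReal

/-- The increment `Δ_t^s X = X_{t+s} - X_t` of a real-valued process at time `t` and scale `s`. -/
def increment {Ω : Type*} (X : ℝ≥0 → Ω → ℝ) (t s : ℝ≥0) (ω : Ω) : ℝ :=
  X (t + s) ω - X t ω

/-- A Lévy process: a process of real random variables, starting at `0`, with stationary and
independent increments. -/
structure IsLevyProcess {Ω : Type*} [MeasurableSpace Ω] (X : ℝ≥0 → Ω → ℝ) (P : Measure Ω) :
    Prop where
  measurable : ∀ t, Measurable (X t)
  zero : ∀ᵐ ω ∂P, X 0 ω = 0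
  indep : HasIndepIncrements X P
  stationary : ∀ t s, IdentDistrib (increment X t s) (increment X 0 s) P P

/-- Self-similarity with scaling exponent `H`: `X_{at}` and `a^H X_t` have the same law for all
`a > 0` and `t > 0`. -/
def IsSelfSimilar {Ω : Type*} [MeasurableSpace Ω] (X : ℝ≥0 → Ω → ℝ) (P : Measure Ω) (H : ℝ) :
    Prop :=
  0 < H ∧ ∀ a t : ℝ≥0, 0 < a → 0 < t →
    IdentDistrib (X (a * t)) (fun ω => (a : ℝ) ^ H * X t ω) P P

/-- The characteristic exponent `ψ` of a strictly stable law of stability index `α`, with scale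
parameter `σ` and skewness parameter `γ`. -/
noncomputable def stableExponent (α σ γ k : ℝ) : ℂ :=
  if α = 1 then (σ * |k| : ℝ) - Complex.I * (γ * k : ℝ)
  else (σ ^ α * |k| ^ α : ℝ) *
    (1 - Complex.I * (γ * Real.tan (Real.pi * α / 2) * Real.sign k : ℝ))

/-- A self-similar Lévy process of stability index `α`: a Lévy process such that `X_t` has the
strictly stable characteristic function `exp (-t ψ)`, where `ψ` has stability index `α`, for some
admissible scale and skewness parameters `σ` and `γ`. -/
structure IsSelfSimilarLevyProcess {Ω : Type*} [MeasurableSpace Ω] (X : ℝ≥0 → Ω → ℝ)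
    (P : Measure Ω) (α : ℝ) : Prop extends IsLevyProcess X P where
  index_pos : 0 < α
  index_le_two : α ≤ 2
  strictlyStable : ∃ σ γ : ℝ, 0 < σ ∧ (α ≠ 1 → -1 ≤ γ ∧ γ ≤ 1) ∧
    ∀ (t : ℝ≥0) (k : ℝ),
      charFun (P.map (X t)) k = Complex.exp (-((t : ℝ) : ℂ) * stableExponent α σ γ k)

/-- Scaling of the characteristic exponent. -/
theorem stableExponent_scale {α : ℝ} (σ γ k : ℝ) (hα : 0 < α) {a : ℝ} (ha : 0 < a) :
    stableExponent α σ γ (a ^ (1 / α) * k) = a * stableExponent α σ γ k := by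
  have hb : 0 < a ^ (1 / α) := Real.rpow_pos_of_pos ha _
  unfold stableExponent
  split_ifs with h
  · subst h
    have : a ^ (1 / (1 : ℝ)) = a := by simp
    rw [this, abs_mul, abs_of_pos ha]
    push_cast
    ring
  · have h1 : |a ^ (1 / α) * k| ^ α = a * |k| ^ α := by
      rw [abs_mul, abs_of_pos hb, Real.mul_rpow hb.le (abs_nonneg k), ← Real.rpow_mul ha.le,
        one_div_mul_cancel hα.ne', Real.rpow_one]
    have h2 : Real.sign (a ^ (1 / α) * k) = Real.sign k := by
      rcases lt_trichotomy k 0 with hk | hk | hk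
      · rw [Real.sign_of_neg hk, Real.sign_of_neg (mul_neg_of_pos_of_neg hb hk)]
      · simp [hk]
      · rw [Real.sign_of_pos hk, Real.sign_of_pos (mul_pos hb hk)]
    rw [h1, h2]
    push_cast
    ring

/-- A self-similar Lévy process of stability index `α` is indeed self-similar, with scaling
exponent `1 / α`. -/
theorem IsSelfSimilarLevyProcess.isSelfSimilar {Ω : Type*} [MeasurableSpace Ω]
    {X : ℝ≥0 → Ω → ℝ} {P : Measure Ω} [IsProbabilityMeasure P] {α : ℝ}
    (hX : IsSelfSimilarLevyProcess X P α) : IsSelfSimilar X P (1 / α) := by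
  refine ⟨one_div_pos.mpr hX.index_pos, fun a t ha _ => ?_⟩
  obtain ⟨σ, γ, -, -, h⟩ := hX.strictlyStable
  have hm := hX.measurable
  refine ⟨(hm _).aemeasurable, ((hm t).const_mul _).aemeasurable, ?_⟩
  have := Measure.isProbabilityMeasure_map (μ := P) (hm (a * t)).aemeasurable
  have := Measure.isProbabilityMeasure_map (μ := P)
    ((hm t).const_mul ((a : ℝ) ^ (1 / α))).aemeasurable
  refine Measure.ext_of_charFun (funext fun k => ?_)
  rw [charFun_map_mul_comp (hm t).aemeasurable, h, h,
    stableExponent_scale σ γ k hX.index_pos (NNReal.coe_pos.mpr ha)]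
  push_cast
  ring_nf

/-! The unit increments `Y m` are i.i.d. with a stable law, and an increment over `τ` steps is a
block sum of them. For reals, `|∑ y i| ^ q` differs from `∑ |y i| ^ q` by at most a constant times
mixed terms `|y i| ^ a * |y j| ^ b` with `i ≠ j`, `a, b > 0` and `a + b = q`
(`exists_abs_sum_rpow_sub_le`). It remains to see that mixed terms are negligible.

The characteristic function gives tails of exact order `r ^ (-α)`. By independence a mixed term has
finite `p`-th moment as soon as `a * p, b * p < α`, so for `p ≤ 1` the law of large numbers bounds
the sum of `N` of them by `O(N ^ p⁻¹)`. If `q > α`, a single large jump already makes `∑ |Y m| ^ q`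
outgrow `N ^ r` for every `r < q / α`; since `a, b < q`, some `p > α / q` meets all constraints. If
`q = α`, take `p = 1`: mixed terms are integrable, while `|Y 0| ^ α` has infinite mean. -/

/-! ### Deterministic bounds: powers of sums up to mixed terms. -/

theorem abs_abs_add_rpow_sub_abs_rpow_le_of_le_one {q : ℝ} (hq : 0 ≤ q) (hq1 : q ≤ 1) (x y : ℝ) :
    |(|x + y| ^ q - |x| ^ q)| ≤ |y| ^ q := by
  have key : ∀ u v : ℝ, |u + v| ^ q ≤ |u| ^ q + |v| ^ q := fun u v =>
    (Real.rpow_le_rpow (abs_nonneg _) (abs_add_le u v) hq).trans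
      (Real.rpow_add_le_add_rpow (abs_nonneg _) (abs_nonneg _) hq hq1)
  have h1 := key x y
  have h2 := key (x + y) (-y)
  rw [add_neg_cancel_right, abs_neg] at h2
  rw [abs_le]
  constructor <;> linarith

/-- Bernoulli's inequality applied to `v / u`, multiplied by `u ^ q`. -/
theorem rpow_sub_rpow_le_mul {q : ℝ} (hq : 1 ≤ q) {u v : ℝ} (hv : 0 ≤ v) (huv : v ≤ u) :
    u ^ q - v ^ q ≤ q * u ^ (q - 1) * (u - v) := by
  rcases hv.trans huv |>.eq_or_lt with hu | hu
  · have : v = 0 := le_antisymm (hu ▸ huv) hv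
    simp [this, ← hu]
  have h := one_add_mul_self_le_rpow_one_add (s := v / u - 1) (p := q)
    (by have := div_nonneg hv hu.le; linarith) hq
  rw [add_sub_cancel, Real.div_rpow hv hu.le, le_div_iff₀ (Real.rpow_pos_of_pos hu _)] at h
  have h3 : u ^ q = u ^ (q - 1) * u := by
    rw [← Real.rpow_add_one hu.ne']; congr 1; ring
  have h4 : (1 + q * (v / u - 1)) * u ^ q = u ^ q - q * u ^ (q - 1) * (u - v) := by
    rw [h3]; field_simp; ring
  linarith

theorem abs_rpow_sub_rpow_le_mul {q : ℝ} (hq : 1 ≤ q) {u v w : ℝ} (hu : 0 ≤ u) (hv : 0 ≤ v)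
    (huw : u ≤ w) (hvw : v ≤ w) : |u ^ q - v ^ q| ≤ q * w ^ (q - 1) * |u - v| := by
  wlog h : v ≤ u generalizing u v
  · rw [abs_sub_comm, abs_sub_comm u]
    exact this hv hu hvw huw (le_of_not_ge h)
  rw [abs_of_nonneg (sub_nonneg.2 h),
    abs_of_nonneg (sub_nonneg.2 (Real.rpow_le_rpow hv h (by linarith)))]
  refine (rpow_sub_rpow_le_mul hq hv h).trans ?_
  have := sub_nonneg.2 h
  gcongr

/-- The `q`-th power of the modulus is additive up to mixed terms of lower order in each
variable. -/
theorem exists_abs_add_rpow_sub_le {q : ℝ} (hq : 0 < q) :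
    ∃ a b C : ℝ, 0 < a ∧ 0 < b ∧ a + b = q ∧ 0 ≤ C ∧ ∀ x y : ℝ,
      |(|x + y| ^ q - |x| ^ q - |y| ^ q)| ≤ C * (|x| ^ a * |y| ^ b + |x| ^ b * |y| ^ a) := by
  -- The right side is symmetric in `x` and `y`, so the smaller variable may be taken to be `y`.
  suffices H : ∃ a b C : ℝ, 0 < a ∧ 0 < b ∧ a + b = q ∧ 0 ≤ C ∧ ∀ x y : ℝ, |y| ≤ |x| →
      |(|x + y| ^ q - |x| ^ q - |y| ^ q)| ≤ C * (|x| ^ a * |y| ^ b) by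
    obtain ⟨a, b, C, ha, hb, hab, hC, h⟩ := H
    refine ⟨a, b, C, ha, hb, hab, hC, fun x y => ?_⟩
    rcases le_total |y| |x| with hxy | hxy
    · refine (h x y hxy).trans ?_
      gcongr
      exact le_add_of_nonneg_right (by positivity)
    · have := h y x hxy
      rw [add_comm y x, sub_right_comm] at this
      refine this.trans ?_
      gcongr
      rw [mul_comm]
      exact le_add_of_nonneg_left (by positivity)
  rcases le_or_gt q 1 with hq1 | hq1
  -- By subadditivity both `|x + y| ^ q - |x| ^ q` and the extra `|y| ^ q` cost at most `|y| ^ q`,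
  -- whence the constant 2.
  · refine ⟨q / 2, q / 2, 2, by positivity, by positivity, by ring, by norm_num, fun x y hxy => ?_⟩
    have h1 := abs_abs_add_rpow_sub_abs_rpow_le_of_le_one hq.le hq1 x y
    have h2 : |y| ^ q ≤ |x| ^ (q / 2) * |y| ^ (q / 2) := by
      calc |y| ^ q = |y| ^ (q / 2) * |y| ^ (q / 2) := by
            rw [← Real.rpow_add_of_nonneg (abs_nonneg _) (by positivity) (by positivity)]
            congr 1; ring
        _ ≤ _ := by gcongr
    have h3 : (0 : ℝ) ≤ |y| ^ q := by positivity
    rw [abs_le] at h1 ⊢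
    constructor <;> linarith
  -- The mean-value bound on `[0, 2 * |x|]` gives `q * 2 ^ (q - 1)`; the `+ 1` absorbs `|y| ^ q`.
  · refine ⟨q - 1, 1, q * 2 ^ (q - 1) + 1, by linarith, one_pos, by ring, by positivity,
      fun x y hxy => ?_⟩
    have h1 := abs_rpow_sub_rpow_le_mul hq1.le (abs_nonneg (x + y)) (abs_nonneg x)
      (w := 2 * |x|) ((abs_add_le x y).trans (by linarith)) (by linarith [abs_nonneg x])
    have h4 : |(|x + y| - |x|)| ≤ |y| := by
      simpa using abs_abs_sub_abs_le_abs_sub (x + y) x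
    have h1' : |(|x + y| ^ q - |x| ^ q)| ≤ q * 2 ^ (q - 1) * (|x| ^ (q - 1) * |y|) := by
      refine h1.trans ?_
      rw [Real.mul_rpow (by norm_num) (abs_nonneg x)]
      calc _ ≤ q * (2 ^ (q - 1) * |x| ^ (q - 1)) * |y| := by gcongr
        _ = _ := by ring
    have h2 : |y| ^ q ≤ |x| ^ (q - 1) * |y| := by
      calc |y| ^ q = |y| ^ (q - 1) * |y| ^ (1 : ℝ) := by
            rw [← Real.rpow_add_of_nonneg (abs_nonneg _) (by linarith) (by positivity)]
            congr 1; ring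
        _ ≤ |x| ^ (q - 1) * |y| := by
            rw [Real.rpow_one]; gcongr
    have h3 : (0 : ℝ) ≤ |y| ^ q := by positivity
    rw [Real.rpow_one]
    rw [abs_le] at h1' ⊢
    constructor <;> linarith

theorem abs_add_rpow_le {a : ℝ} (ha : 0 ≤ a) (x y : ℝ) :
    |x + y| ^ a ≤ 2 ^ a * (|x| ^ a + |y| ^ a) := by
  have h : |x + y| ≤ 2 * max |x| |y| := by
    linarith [abs_add_le x y, le_max_left |x| |y|, le_max_right |x| |y|]
  refine (Real.rpow_le_rpow (abs_nonneg _) h ha).trans ?_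
  rw [Real.mul_rpow (by norm_num) (by positivity)]
  gcongr
  rcases le_total |x| |y| with h | h
  · rw [max_eq_right h]; exact le_add_of_nonneg_left (by positivity)
  · rw [max_eq_left h]; exact le_add_of_nonneg_right (by positivity)

theorem exists_abs_sum_rpow_le {a : ℝ} (ha : 0 < a) (n : ℕ) :
    ∃ K : ℝ, 0 ≤ K ∧ ∀ y : ℕ → ℝ,
      |∑ i ∈ Finset.range n, y i| ^ a ≤ K * ∑ i ∈ Finset.range n, |y i| ^ a := by
  induction n with
  | zero => exact ⟨0, le_rfl, fun y => by simp [Real.zero_rpow ha.ne']⟩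
  | succ n ih =>
    obtain ⟨K, hK, h⟩ := ih
    refine ⟨2 ^ a * (K + 1), by positivity, fun y => ?_⟩
    rw [Finset.sum_range_succ, Finset.sum_range_succ]
    refine (abs_add_rpow_le ha.le _ _).trans ?_
    rw [mul_assoc]
    gcongr
    have h1 := h y
    have h2 : 0 ≤ ∑ i ∈ Finset.range n, |y i| ^ a := by positivity
    have h3 : 0 ≤ K * |y n| ^ a := by positivity
    nlinarith

/-- The `q`-th power of the modulus of a sum agrees with the sum of the `q`-th powers up to mixed
terms of lower order in each variable. -/
theorem exists_abs_sum_rpow_sub_le {q : ℝ} (hq : 0 < q) :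
    ∃ a b : ℝ, 0 < a ∧ 0 < b ∧ a + b = q ∧ ∀ n : ℕ, ∃ C : ℝ, 0 ≤ C ∧ ∀ y : ℕ → ℝ,
      |(|∑ i ∈ Finset.range n, y i| ^ q - ∑ i ∈ Finset.range n, |y i| ^ q)| ≤
        C * ∑ j ∈ Finset.range n, ∑ i ∈ Finset.range j,
          (|y i| ^ a * |y j| ^ b + |y i| ^ b * |y j| ^ a) := by
  obtain ⟨a, b, C₀, ha, hb, hab, hC₀, h₀⟩ := exists_abs_add_rpow_sub_le hq
  refine ⟨a, b, ha, hb, hab, fun n => ?_⟩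
  induction n with
  | zero => exact ⟨0, le_rfl, fun y => by simp [Real.zero_rpow hq.ne']⟩
  | succ n ih =>
    obtain ⟨C, hC, h⟩ := ih
    obtain ⟨K, hK, hKy⟩ := exists_abs_sum_rpow_le ha n
    obtain ⟨L, hL, hLy⟩ := exists_abs_sum_rpow_le hb n
    -- Adding `y n` to the partial sum costs mixed terms in the sum and `y n`; `K` and `L` expand
    -- the powers of the sum into its summands.
    refine ⟨C + C₀ * (K + L), by positivity, fun y => ?_⟩
    rw [Finset.sum_range_succ, Finset.sum_range_succ, Finset.sum_range_succ]
    set S := ∑ i ∈ Finset.range n, y i with hS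
    set R := ∑ j ∈ Finset.range n, ∑ i ∈ Finset.range j,
          (|y i| ^ a * |y j| ^ b + |y i| ^ b * |y j| ^ a) with hR
    have hR0 : 0 ≤ R := by positivity
    rw [Finset.sum_add_distrib, ← Finset.sum_mul, ← Finset.sum_mul]
    have h1 := h y
    have h2 := h₀ S (y n)
    have h3 := hKy y
    have h4 := hLy y
    rw [← hS] at h1 h3 h4
    rw [← hR] at h1
    set A := ∑ i ∈ Finset.range n, |y i| ^ a
    set B := ∑ i ∈ Finset.range n, |y i| ^ b
    have hA : 0 ≤ A := by positivity
    have hB : 0 ≤ B := by positivity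
    have hya : 0 ≤ |y n| ^ a := by positivity
    have hyb : 0 ≤ |y n| ^ b := by positivity
    have h5 : |S| ^ a * |y n| ^ b + |S| ^ b * |y n| ^ a ≤
        (K + L) * (A * |y n| ^ b + B * |y n| ^ a) := by
      have e1 : |S| ^ a * |y n| ^ b ≤ (K * A) * |y n| ^ b := by gcongr
      have e2 : |S| ^ b * |y n| ^ a ≤ (L * B) * |y n| ^ a := by gcongr
      have e3 : 0 ≤ L * A * |y n| ^ b := by positivity
      have e4 : 0 ≤ K * B * |y n| ^ a := by positivity
      linarith
    set Q := A * |y n| ^ b + B * |y n| ^ a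
    have hQ : 0 ≤ Q := by positivity
    have h6 := mul_le_mul_of_nonneg_left h5 hC₀
    have h7 : |(|S + y n| ^ q - (∑ i ∈ Finset.range n, |y i| ^ q + |y n| ^ q))| ≤
        C * R + C₀ * ((K + L) * Q) := by
      rw [abs_le] at h1 h2 ⊢
      constructor <;> linarith
    refine h7.trans ?_
    have e5 : 0 ≤ C * Q := by positivity
    have e6 : 0 ≤ C₀ * (K + L) * R := by positivity
    linarith

/-! ### Tails and moments from the characteristic function. -/

/-- The truncation inequality: the tail at `r` is controlled by the integral of `1 - charFun μ` over
`[-2 / r, 2 / r]`. -/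
theorem measureReal_abs_gt_le_of_charFun {μ : Measure ℝ} [IsProbabilityMeasure μ] {α K : ℝ}
    (hα : 0 ≤ α) (hK : ∀ k, ‖1 - charFun μ k‖ ≤ K * |k| ^ α) {r : ℝ} (hr : 0 < r) :
    μ.real {x | r < |x|} ≤ 2 * 2 ^ α * K * r ^ (-α) := by
  have hK0 : 0 ≤ K := by simpa using (norm_nonneg _).trans (hK 1)
  refine (measureReal_abs_gt_le_integral_charFun hr).trans ?_
  have h1 : ‖∫ t in (-2 * r⁻¹)..(2 * r⁻¹), 1 - charFun μ t‖ ≤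
      K * (2 * r⁻¹) ^ α * |2 * r⁻¹ - -2 * r⁻¹| := by
    refine intervalIntegral.norm_integral_le_of_norm_le_const fun t ht => (hK t).trans ?_
    have hr' : 0 < r⁻¹ := inv_pos.2 hr
    rw [Set.uIoc_of_le (by linarith)] at ht
    gcongr
    exact abs_le.2 ⟨by linarith [ht.1], ht.2⟩
  have h2 : |2 * r⁻¹ - -2 * r⁻¹| = 4 * r⁻¹ := by
    rw [abs_of_nonneg] <;> have : 0 < r⁻¹ := inv_pos.2 hr
    · ring
    · linarith
  have h3 : (2 * r⁻¹) ^ α = 2 ^ α * r ^ (-α) := by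
    rw [Real.mul_rpow (by norm_num) (by positivity), Real.rpow_neg hr.le, Real.inv_rpow hr.le]
  rw [h2, h3] at h1
  calc _ ≤ 2⁻¹ * r * (K * (2 ^ α * r ^ (-α)) * (4 * r⁻¹)) := by gcongr
    _ = _ := by field_simp; ring

theorem measure_lt_le_ofReal_of_tail {μ : Measure ℝ} [IsProbabilityMeasure μ] {α C : ℝ}
    (hC : ∀ r, 0 < r → μ.real {x | r < |x|} ≤ C * r ^ (-α)) {r : ℝ} (hr : 0 < r) :
    μ {x | r < |x|} ≤ ENNReal.ofReal (C * r ^ (-α)) := by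
  rw [← ofReal_measureReal]
  exact ENNReal.ofReal_le_ofReal (hC r hr)

/-- Layer-cake formula: the tail is bounded by 1 on `(0, 1]` and by the hypothesis beyond. -/
theorem integrable_abs_rpow_of_tail {μ : Measure ℝ} [IsProbabilityMeasure μ] {α C s : ℝ}
    (hs : 0 < s) (hsα : s < α) (hC : ∀ r, 0 < r → μ.real {x | r < |x|} ≤ C * r ^ (-α)) :
    Integrable (fun x => |x| ^ s) μ := by
  refine ⟨(by fun_prop : Measurable fun x : ℝ => |x| ^ s).aestronglyMeasurable, ?_⟩
  rw [hasFiniteIntegral_iff_ofReal (ae_of_all _ fun x => by positivity),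
    lintegral_rpow_eq_lintegral_meas_lt_mul μ (ae_of_all _ fun x => abs_nonneg x)
      (by fun_prop) hs]
  refine ENNReal.mul_lt_top ENNReal.ofReal_lt_top ?_
  rw [← Set.Ioc_union_Ioi_eq_Ioi zero_le_one]
  refine (lintegral_union_le _ _ _).trans_lt (ENNReal.add_lt_top.2 ⟨?_, ?_⟩)
  · have h : IntegrableOn (fun t : ℝ => t ^ (s - 1)) (Set.Ioc 0 1) :=
      (intervalIntegrable_iff_integrableOn_Ioc_of_le zero_le_one).1
        (intervalIntegral.intervalIntegrable_rpow' (by linarith))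
    refine lt_of_le_of_lt (setLIntegral_mono (by fun_prop) fun t _ => ?_) h.setLIntegral_lt_top
    exact mul_le_of_le_one_left (by positivity) prob_le_one
  · have h : IntegrableOn (fun t : ℝ => C * t ^ (s - α - 1)) (Set.Ioi 1) :=
      (integrableOn_Ioi_rpow_of_lt (by linarith) one_pos).const_mul C
    refine lt_of_le_of_lt (setLIntegral_mono (by fun_prop) fun t ht => ?_) h.setLIntegral_lt_top
    have ht0 : (0 : ℝ) < t := one_pos.trans ht
    refine (mul_le_mul_left (measure_lt_le_ofReal_of_tail hC ht0) _).trans ?_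
    rw [← ENNReal.ofReal_mul' (by positivity), mul_assoc, ← Real.rpow_add ht0]
    refine le_of_eq ?_
    congr 3; ring

/-- Layer-cake formula again; `α < 2` makes `t ^ (1 - α)` integrable at the origin. -/
theorem integral_min_abs_sq_le_of_tail {μ : Measure ℝ} [IsProbabilityMeasure μ] {α C : ℝ}
    (hα : α < 2) (hC : ∀ r, 0 < r → μ.real {x | r < |x|} ≤ C * r ^ (-α)) {B : ℝ} (hB : 0 < B) :
    ∫ x, min |x| B ^ 2 ∂μ ≤ 2 * C / (2 - α) * B ^ (2 - α) := by
  have hC0 : 0 ≤ C := by simpa using measureReal_nonneg.trans (hC 1 one_pos)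
  have hα' : 0 < 2 - α := by linarith
  have hm : Measurable fun x : ℝ => min |x| B := by fun_prop
  rw [integral_eq_lintegral_of_nonneg_ae (ae_of_all _ fun x => by positivity)
    (hm.pow_const 2).aestronglyMeasurable]
  refine ENNReal.toReal_le_of_le_ofReal (by positivity) ?_
  have h := lintegral_rpow_eq_lintegral_meas_lt_mul μ (f := fun x => min |x| B)
    (ae_of_all _ fun x => le_min (abs_nonneg x) hB.le) hm.aemeasurable two_pos
  simp only [Real.rpow_two] at h
  rw [h, ← Set.Ioc_union_Ioi_eq_Ioi hB.le]
  have hI : IntegrableOn (fun t : ℝ => C * t ^ (1 - α)) (Set.Ioc 0 B) :=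
    ((intervalIntegrable_iff_integrableOn_Ioc_of_le hB.le).1
        (intervalIntegral.intervalIntegrable_rpow' (by linarith))).const_mul C
  have h1 : ∫⁻ t in Set.Ioc 0 B, μ {x | t < min |x| B} * ENNReal.ofReal (t ^ ((2 : ℝ) - 1)) ≤
      ENNReal.ofReal (C * (B ^ (2 - α) / (2 - α))) := by
    have e : C * (B ^ (2 - α) / (2 - α)) = ∫ t in Set.Ioc 0 B, C * t ^ (1 - α) := by
      rw [integral_const_mul, ← intervalIntegral.integral_of_le hB.le,
        integral_rpow (Or.inl (by linarith)), show 1 - α + 1 = 2 - α by ring,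
        Real.zero_rpow hα'.ne', sub_zero]
    rw [e, ofReal_integral_eq_lintegral_ofReal hI
      (ae_restrict_of_forall_mem measurableSet_Ioc fun t ht => by
        have := ht.1; positivity)]
    refine setLIntegral_mono (by fun_prop) fun t ht => ?_
    have ht0 : 0 < t := ht.1
    refine (mul_le_mul_left ((measure_mono fun x hx => ?_).trans
      (measure_lt_le_ofReal_of_tail hC ht0)) _).trans ?_
    · exact (lt_min_iff.1 (show t < min |x| B from hx)).1
    · rw [← ENNReal.ofReal_mul' (by positivity), mul_assoc, ← Real.rpow_add ht0]
      refine le_of_eq ?_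
      congr 3; ring
  have h2 : ∫⁻ t in Set.Ioi B, μ {x | t < min |x| B} * ENNReal.ofReal (t ^ ((2 : ℝ) - 1)) = 0 := by
    rw [setLIntegral_congr_fun (g := fun _ => 0) measurableSet_Ioi, lintegral_zero]
    intro t ht
    have : {x : ℝ | t < min |x| B} = ∅ := by
      ext x
      simp [(show B < t from ht).le]
    change μ {x : ℝ | t < min |x| B} * _ = 0
    rw [this, measure_empty, zero_mul]
  refine (mul_le_mul_right ((lintegral_union_le _ _ _).trans (add_le_add h1 h2.le)) _).trans ?_
  rw [add_zero, ← ENNReal.ofReal_mul (by norm_num)]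
  refine le_of_eq ?_
  congr 1; ring

theorem one_sub_re_charFun_eq {μ : Measure ℝ} [IsProbabilityMeasure μ] (k : ℝ) :
    1 - (charFun μ k).re = ∫ x, (1 - Real.cos (k * x)) ∂μ := by
  have hi : Integrable (fun x : ℝ => Complex.exp (k * x * Complex.I)) μ := by
    refine Integrable.of_bound (C := 1) (by fun_prop) (ae_of_all _ fun x => ?_)
    rw [← Complex.ofReal_mul, Complex.norm_exp_ofReal_mul_I]
  have hc : Integrable (fun x : ℝ => Real.cos (k * x)) μ :=
    Integrable.of_bound (C := 1) (by fun_prop) (ae_of_all _ fun x => Real.abs_cos_le_one _)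
  rw [integral_sub (integrable_const 1) hc, charFun_apply_real]
  have : (∫ x : ℝ, Complex.exp (k * x * Complex.I) ∂μ).re =
      ∫ x : ℝ, (Complex.exp (k * x * Complex.I)).re ∂μ := (integral_re hi).symm
  rw [this]
  simp only [← Complex.ofReal_mul, Complex.exp_ofReal_mul_I_re]
  simp

/-- Bound `1 - cos (k * x)` by `(k * x) ^ 2 / 2` where `|x| ≤ B` and by 2 elsewhere. -/
theorem one_sub_re_charFun_le {μ : Measure ℝ} [IsProbabilityMeasure μ] (k : ℝ) {B : ℝ}
    (hB : 0 < B) :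
    1 - (charFun μ k).re ≤ k ^ 2 / 2 * ∫ x, min |x| B ^ 2 ∂μ + 2 * μ.real {x | B < |x|} := by
  have hms : MeasurableSet {x : ℝ | B < |x|} := measurableSet_lt measurable_const (by fun_prop)
  have hi1 : Integrable (fun x : ℝ => min |x| B ^ 2) μ := by
    refine Integrable.of_bound (C := B ^ 2) (by fun_prop) (ae_of_all _ fun x => ?_)
    rw [Real.norm_of_nonneg (by positivity)]
    gcongr
    exact min_le_right _ _
  have hi2 : Integrable ({x : ℝ | B < |x|}.indicator fun _ => (1 : ℝ)) μ :=
    (integrable_const 1).indicator hms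
  have hc : Integrable (fun x : ℝ => Real.cos (k * x)) μ :=
    Integrable.of_bound (C := 1) (by fun_prop) (ae_of_all _ fun x => Real.abs_cos_le_one _)
  rw [one_sub_re_charFun_eq]
  calc ∫ x, (1 - Real.cos (k * x)) ∂μ
      ≤ ∫ x, (k ^ 2 / 2 * min |x| B ^ 2 + 2 * {x : ℝ | B < |x|}.indicator (fun _ => (1 : ℝ)) x) ∂μ := by
        refine integral_mono ((integrable_const 1).sub hc)
          ((hi1.const_mul _).add (hi2.const_mul _)) fun x => ?_
        simp only
        by_cases hx : B < |x|
        · rw [Set.indicator_of_mem (show x ∈ {x : ℝ | B < |x|} from hx)]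
          have : 0 ≤ k ^ 2 / 2 * min |x| B ^ 2 := by positivity
          linarith [Real.neg_one_le_cos (k * x)]
        · rw [Set.indicator_of_notMem (show x ∉ {x : ℝ | B < |x|} from hx),
            min_eq_left (not_lt.1 hx), sq_abs]
          have := Real.one_sub_sq_div_two_le_cos (x := k * x)
          linarith [mul_pow k x 2]
    _ = _ := by
        rw [integral_add (hi1.const_mul _) (hi2.const_mul _), integral_const_mul,
          integral_const_mul, integral_indicator_const _ hms, smul_eq_mul, mul_one]

/-- Two-sided bounds of order `|k| ^ α` on a characteristic function near the origin give a lower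
bound of order `r ^ (-α)` on the tail. -/
theorem exists_le_measureReal_abs_gt_of_charFun {μ : Measure ℝ} [IsProbabilityMeasure μ]
    {α K c : ℝ} (hα : 0 < α) (hα2 : α < 2) (hc : 0 < c)
    (hK : ∀ k, ‖1 - charFun μ k‖ ≤ K * |k| ^ α)
    (hL : ∀ k, |k| ≤ 1 → c * |k| ^ α ≤ 1 - (charFun μ k).re) :
    ∃ d η : ℝ, 0 < d ∧ 0 < η ∧ ∀ r, η ≤ r → d * r ^ (-α) ≤ μ.real {x | r < |x|} := by
  have hα' : 0 < 2 - α := by linarith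
  have hK0 : 0 ≤ K := by simpa using (norm_nonneg _).trans (hK 1)
  set C := 2 * (2 * 2 ^ α * K) / (2 - α) with hCdef
  have hC0 : 0 ≤ C := by positivity
  -- Test at frequency `η / r` with truncation at `r`. This `η` makes the second-moment term at most
  -- half of `c * (η / r) ^ α`, so the tail must supply the other half; `η ≤ r` keeps the frequency
  -- in `[0, 1]`.
  set η := (c / (C + 1)) ^ (1 / (2 - α)) with hη
  have hη0 : 0 < η := by positivity
  have hηα : η ^ (2 - α) = c / (C + 1) := by
    rw [hη, ← Real.rpow_mul (by positivity), one_div_mul_cancel hα'.ne', Real.rpow_one]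
  refine ⟨c / 4 * η ^ α, η, by positivity, hη0, fun r hr => ?_⟩
  have hr0 : 0 < r := hη0.trans_le hr
  have hk0 : 0 < η / r := by positivity
  have h1 := hL (η / r) (by rw [abs_of_pos hk0]; exact div_le_one_of_le₀ hr hr0.le)
  have h2 := one_sub_re_charFun_le (μ := μ) (η / r) hr0
  have h3 := integral_min_abs_sq_le_of_tail hα2
    (fun r hr => measureReal_abs_gt_le_of_charFun hα.le hK hr) hr0
  rw [← hCdef] at h3
  rw [abs_of_pos hk0] at h1
  have h4 : (η / r) ^ 2 / 2 * ∫ x, min |x| r ^ 2 ∂μ ≤ c / 2 * (η / r) ^ α := by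
    calc _ ≤ (η / r) ^ 2 / 2 * (C * r ^ (2 - α)) := by gcongr
      _ = C / 2 * η ^ (2 - α) * (η / r) ^ α := by
          rw [Real.div_rpow hη0.le hr0.le, Real.rpow_sub hr0, Real.rpow_sub hη0, Real.rpow_two,
            Real.rpow_two]
          have := Real.rpow_pos_of_pos hη0 α
          have := Real.rpow_pos_of_pos hr0 α
          field_simp
      _ ≤ _ := by
          rw [hηα]
          gcongr ?_ * _
          rw [div_mul_div_comm, div_le_div_iff₀ (by positivity) (by positivity)]
          nlinarith
  have h5 : c / 4 * η ^ α * r ^ (-α) = c / 4 * (η / r) ^ α := by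
    rw [Real.div_rpow hη0.le hr0.le, Real.rpow_neg hr0.le]; ring
  rw [h5]
  linarith

/-- Integrability would force the integral of `|x| ^ α` over `{r < |x|}` to 0, but it is at least `r
^ α * μ.real {x | r < |x|}`, hence at least `d`, for large `r`. -/
theorem not_integrable_abs_rpow_of_le_tail {μ : Measure ℝ} [IsProbabilityMeasure μ]
    {α d η : ℝ} (hα : 0 < α) (hd : 0 < d)
    (hη : ∀ r, η ≤ r → d * r ^ (-α) ≤ μ.real {x | r < |x|}) :
    ¬ Integrable (fun x => |x| ^ α) μ := by
  intro hi
  have hms (r : ℝ) : MeasurableSet {x : ℝ | r < |x|} :=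
    measurableSet_lt measurable_const (by fun_prop)
  have hlim : Tendsto (fun r : ℝ => ∫ x, {x : ℝ | r < |x|}.indicator (fun x => |x| ^ α) x ∂μ)
      atTop (𝓝 (∫ _, (0 : ℝ) ∂μ)) := by
    refine tendsto_integral_filter_of_dominated_convergence (fun x => |x| ^ α)
      (Eventually.of_forall fun r => hi.1.indicator (hms r))
      (Eventually.of_forall fun r => ae_of_all _ fun x => ?_) hi (ae_of_all _ fun x => ?_)
    · rw [Real.norm_of_nonneg (Set.indicator_nonneg (fun _ _ => by positivity) _)]
      exact Set.indicator_le_self' (fun _ _ => by positivity) _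
    · refine tendsto_const_nhds.congr' ?_
      filter_upwards [eventually_ge_atTop |x|] with r hr
      rw [Set.indicator_of_notMem]
      exact not_lt.2 hr
  rw [integral_zero] at hlim
  have := hlim.eventually_lt_const hd
  obtain ⟨r, h1, h2, h3⟩ := (this.and ((eventually_ge_atTop η).and (eventually_gt_atTop 0))).exists
  refine absurd h1 (not_lt.2 ?_)
  rw [integral_indicator (hms r)]
  calc d = r ^ α * (d * r ^ (-α)) := by
        rw [Real.rpow_neg h3.le]; have := Real.rpow_pos_of_pos h3 α; field_simp
    _ ≤ r ^ α * μ.real {x | r < |x|} := by gcongr; exact hη r h2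
    _ = ∫ _ in {x : ℝ | r < |x|}, r ^ α ∂μ := by
        rw [setIntegral_const, smul_eq_mul, mul_comm]
    _ ≤ _ := by
        refine setIntegral_mono_on (integrable_const _).integrableOn hi.integrableOn (hms r) ?_
        intro x hx
        exact Real.rpow_le_rpow h3.le (le_of_lt hx) hα.le

theorem stableExponent_re (α σ γ k : ℝ) : (stableExponent α σ γ k).re = σ ^ α * |k| ^ α := by
  unfold stableExponent
  split_ifs with h
  · subst h
    simp
  · simp only [Complex.mul_re, Complex.sub_re, Complex.sub_im, Complex.ofReal_re,
      Complex.ofReal_im, Complex.I_re, Complex.I_im, Complex.one_re, Complex.one_im]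
    ring

theorem exists_norm_stableExponent_le (α σ γ : ℝ) (hσ : 0 ≤ σ) :
    ∃ M : ℝ, 0 ≤ M ∧ ∀ k, ‖stableExponent α σ γ k‖ ≤ M * |k| ^ α := by
  by_cases h : α = 1
  · refine ⟨σ + |γ|, by positivity, fun k => ?_⟩
    rw [stableExponent, if_pos h, h, Real.rpow_one]
    refine (norm_sub_le _ _).trans ?_
    rw [norm_mul, Complex.norm_I, Complex.norm_real, Complex.norm_real, Real.norm_eq_abs,
      Real.norm_eq_abs, abs_mul, abs_mul, abs_abs, abs_of_nonneg hσ]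
    exact le_of_eq (by ring)
  · refine ⟨σ ^ α * (1 + |γ * Real.tan (Real.pi * α / 2)|), by positivity, fun k => ?_⟩
    rw [stableExponent, if_neg h, norm_mul, Complex.norm_real, Real.norm_of_nonneg (by positivity)]
    have hs : |Real.sign k| ≤ 1 := by
      rcases Real.sign_apply_eq k with h | h | h <;> simp [h]
    have h1 : ‖(1 : ℂ) - Complex.I * (γ * Real.tan (Real.pi * α / 2) * Real.sign k : ℝ)‖ ≤
        1 + |γ * Real.tan (Real.pi * α / 2)| := by
      refine (norm_sub_le _ _).trans ?_
      rw [norm_one, norm_mul, Complex.norm_I, one_mul, Complex.norm_real, Real.norm_eq_abs,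
        abs_mul (γ * _)]
      gcongr
      exact mul_le_of_le_one_right (abs_nonneg _) hs
    calc _ ≤ σ ^ α * |k| ^ α * (1 + |γ * Real.tan (Real.pi * α / 2)|) := by gcongr
      _ = _ := by ring

theorem norm_one_sub_exp_neg_le {z : ℂ} (hz : 0 ≤ z.re) : ‖1 - Complex.exp (-z)‖ ≤ 2 * ‖z‖ := by
  rcases le_total ‖z‖ 1 with h | h
  · rw [norm_sub_rev, ← norm_neg z]
    exact Complex.norm_exp_sub_one_le (by rwa [norm_neg])
  · refine (norm_sub_le _ _).trans ?_
    rw [norm_one, Complex.norm_exp, Complex.neg_re]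
    have := Real.exp_le_one_iff.2 (neg_nonpos.2 hz)
    linarith

/-- The upper bound uses `|1 - exp (-z)| ≤ 2 * |z|`. The lower one needs only the real part of the
exponent, through `1 - exp (-s) ≥ s / (1 + s)`. -/
theorem exists_charFun_bounds_of_stableExponent {μ : Measure ℝ} {α σ γ : ℝ}
    (hσ : 0 < σ) (hα : 0 < α) (h : ∀ k, charFun μ k = Complex.exp (-stableExponent α σ γ k)) :
    ∃ K c : ℝ, 0 < c ∧ (∀ k, ‖1 - charFun μ k‖ ≤ K * |k| ^ α) ∧
      ∀ k, |k| ≤ 1 → c * |k| ^ α ≤ 1 - (charFun μ k).re := by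
  obtain ⟨M, hM, hMk⟩ := exists_norm_stableExponent_le α σ γ hσ.le
  refine ⟨2 * M, σ ^ α / (1 + σ ^ α), by positivity, fun k => ?_, fun k hk => ?_⟩
  · rw [h]
    refine (norm_one_sub_exp_neg_le ?_).trans ?_
    · rw [stableExponent_re]; positivity
    · linarith [hMk k]
  · have h1 : (charFun μ k).re ≤ Real.exp (-(σ ^ α * |k| ^ α)) := by
      refine (Complex.re_le_norm _).trans ?_
      rw [h, Complex.norm_exp, Complex.neg_re, stableExponent_re]
    set s := σ ^ α * |k| ^ α with hs
    have hσα : 0 < σ ^ α := by positivity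
    have hs0 : 0 ≤ s := by positivity
    have hs1 : s ≤ σ ^ α :=
      mul_le_of_le_one_right hσα.le (Real.rpow_le_one (abs_nonneg _) hk hα.le)
    have h2 : Real.exp (-s) ≤ 1 / (1 + s) := by
      rw [Real.exp_neg, ← one_div]
      have := Real.add_one_le_exp s
      exact one_div_le_one_div_of_le (by positivity) (by linarith)
    have h3 : σ ^ α / (1 + σ ^ α) * |k| ^ α ≤ s / (1 + s) := by
      calc _ = s / (1 + σ ^ α) := by rw [hs]; ring
        _ ≤ _ := by gcongr
    have h4 : s / (1 + s) = 1 - 1 / (1 + s) := by field_simp; ring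
    linarith

theorem summable_exp_neg_mul_rpow {c δ : ℝ} (hc : 0 < c) (hδ : 0 < δ) :
    Summable fun n : ℕ => Real.exp (-c * (n : ℝ) ^ δ) := by
  -- The exponent turns `n ^ δ` into the summable `n ^ (-2)`.
  have h := (isLittleO_exp_neg_mul_rpow_atTop hc (-(2 / δ))).comp_tendsto
    ((tendsto_rpow_atTop hδ).comp tendsto_natCast_atTop_atTop)
  refine summable_of_isBigO_nat (Real.summable_nat_rpow_inv.2 one_lt_two) (h.isBigO.trans ?_)
  refine Asymptotics.isBigO_of_le _ fun n => ?_
  simp only [Function.comp]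
  rw [← Real.rpow_mul (by positivity), ← Real.rpow_neg (by positivity)]
  refine le_of_eq ?_
  congr 2
  field_simp

/-! ### Growth of sums of i.i.d. variables. -/

section IID

variable {Ω : Type*} [MeasurableSpace Ω] {P : Measure Ω} [IsProbabilityMeasure P] {Y : ℕ → Ω → ℝ}

theorem measure_forall_abs_le_le_exp (hm : ∀ n, Measurable (Y n)) (hind : iIndepFun Y P)
    (hid : ∀ n, IdentDistrib (Y n) (Y 0) P P) {x u : ℝ}
    (hu : u ≤ (P.map (Y 0)).real {y | x < |y|}) (N : ℕ) :
    P {ω | ∀ m < N, |Y m ω| ≤ x} ≤ ENNReal.ofReal (Real.exp (-u * N)) := by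
  have hms : MeasurableSet {y : ℝ | |y| ≤ x} := measurableSet_le (by fun_prop) measurable_const
  have hp : IsProbabilityMeasure (P.map (Y 0)) :=
    Measure.isProbabilityMeasure_map (hm 0).aemeasurable
  have h1 : {ω | ∀ m < N, |Y m ω| ≤ x} = ⋂ m ∈ Finset.range N, Y m ⁻¹' {y : ℝ | |y| ≤ x} := by
    ext ω; simp
  have h2 (m : ℕ) : P (Y m ⁻¹' {y : ℝ | |y| ≤ x}) ≤ ENNReal.ofReal (Real.exp (-u)) := by
    rw [← Measure.map_apply (hm m) hms, (hid m).map_eq, ← ofReal_measureReal]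
    refine ENNReal.ofReal_le_ofReal ?_
    have h3 : {y : ℝ | |y| ≤ x} = {y : ℝ | x < |y|}ᶜ := by ext; simp
    rw [h3, probReal_compl_eq_one_sub (measurableSet_lt measurable_const (by fun_prop))]
    linarith [Real.add_one_le_exp (-u)]
  rw [h1, hind.measure_inter_preimage_eq_mul (Finset.range N) fun _ _ => hms]
  calc _ ≤ ∏ _m ∈ Finset.range N, ENNReal.ofReal (Real.exp (-u)) := by gcongr; exact h2 _
    _ = _ := by
      rw [Finset.prod_const, Finset.card_range, ← ENNReal.ofReal_pow (by positivity),
        ← Real.exp_nat_mul]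
      ring_nf

/-- One summand with `|Y m| > N ^ (r / q)` suffices. The probability that none of the first `N` is
that large is at most `exp (-d * N ^ (1 - r * α / q))` for large `N`, so Borel–Cantelli applies. -/
theorem ae_eventually_rpow_le_sum (hm : ∀ n, Measurable (Y n)) (hind : iIndepFun Y P)
    (hid : ∀ n, IdentDistrib (Y n) (Y 0) P P) {α d η q r : ℝ} (hα : 0 < α) (hd : 0 < d)
    (htail : ∀ x, η ≤ x → d * x ^ (-α) ≤ (P.map (Y 0)).real {y | x < |y|})
    (hq : 0 < q) (hr : 0 < r) (hrq : r < q / α) :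
    ∀ᵐ ω ∂P, ∀ᶠ N : ℕ in atTop, (N : ℝ) ^ r ≤ ∑ m ∈ Finset.range N, |Y m ω| ^ q := by
  have hδ : 0 < 1 - r / q * α := by
    rw [lt_div_iff₀ hα] at hrq
    rw [div_mul_eq_mul_div, sub_pos, div_lt_one hq]
    exact hrq
  have hlim : Tendsto (fun N : ℕ => (N : ℝ) ^ (r / q)) atTop atTop :=
    (tendsto_rpow_atTop (by positivity)).comp tendsto_natCast_atTop_atTop
  obtain ⟨N₀, hN₀⟩ := eventually_atTop.1 (hlim.eventually_ge_atTop η)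
  have hsum := summable_exp_neg_mul_rpow hd hδ
  -- The condition `N₀ + 1 ≤ N` empties the events for which the tail bound is unavailable, and
  -- excludes `N = 0`.
  have hae := ae_eventually_notMem (μ := P)
    (s := fun N : ℕ => {ω | N₀ + 1 ≤ N ∧ ∀ m < N, |Y m ω| ≤ (N : ℝ) ^ (r / q)}) ?_
  · filter_upwards [hae] with ω hω
    filter_upwards [hω, eventually_ge_atTop (N₀ + 1)] with N hN hN1
    have : ∃ m < N, (N : ℝ) ^ (r / q) < |Y m ω| := by
      by_contra! hcon
      exact hN ⟨hN1, hcon⟩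
    obtain ⟨m, hmN, hlt⟩ := this
    calc (N : ℝ) ^ r = ((N : ℝ) ^ (r / q)) ^ q := by
          rw [← Real.rpow_mul (by positivity), div_mul_cancel₀ _ hq.ne']
      _ ≤ |Y m ω| ^ q := by gcongr
      _ ≤ _ := Finset.single_le_sum (f := fun m => |Y m ω| ^ q) (fun _ _ => by positivity)
          (Finset.mem_range.2 hmN)
  · refine ne_top_of_le_ne_top hsum.tsum_ofReal_ne_top (ENNReal.tsum_le_tsum fun N => ?_)
    by_cases hN : N₀ + 1 ≤ N
    · have hN0 : (0 : ℝ) < N := by exact_mod_cast (Nat.succ_pos _).trans_le hN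
      refine (measure_mono fun ω hω => hω.2).trans
        ((measure_forall_abs_le_le_exp hm hind hid (htail _ (hN₀ N (by omega))) N).trans ?_)
      refine ENNReal.ofReal_le_ofReal (Real.exp_le_exp.2 (le_of_eq ?_))
      rw [← Real.rpow_mul hN0.le, Real.rpow_sub hN0, Real.rpow_one, mul_neg, Real.rpow_neg hN0.le]
      ring
    · simp [hN]

theorem ae_tendsto_sum_div_rpow_atTop (hm : ∀ n, Measurable (Y n)) (hind : iIndepFun Y P)
    (hid : ∀ n, IdentDistrib (Y n) (Y 0) P P) {α d η q r : ℝ} (hα : 0 < α) (hd : 0 < d)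
    (htail : ∀ x, η ≤ x → d * x ^ (-α) ≤ (P.map (Y 0)).real {y | x < |y|})
    (hq : 0 < q) (hr : 0 < r) (hrq : r < q / α) :
    ∀ᵐ ω ∂P, Tendsto (fun N : ℕ => (∑ m ∈ Finset.range N, |Y m ω| ^ q) / (N : ℝ) ^ r)
      atTop atTop := by
  obtain ⟨r', hr', hr'q⟩ := exists_between hrq
  filter_upwards [ae_eventually_rpow_le_sum hm hind hid hα hd htail hq (hr.trans hr') hr'q]
    with ω hω
  have hlim : Tendsto (fun N : ℕ => (N : ℝ) ^ (r' - r)) atTop atTop :=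
    (tendsto_rpow_atTop (by linarith)).comp tendsto_natCast_atTop_atTop
  refine tendsto_atTop_mono' _ ?_ hlim
  filter_upwards [hω, eventually_gt_atTop 0] with N hN hN0
  have hN0' : (0 : ℝ) < N := by exact_mod_cast hN0
  rw [Real.rpow_sub hN0']
  gcongr

/-- The strong law of large numbers for nonnegative variables of infinite mean. -/
theorem ae_tendsto_average_atTop_of_not_integrable {Z : ℕ → Ω → ℝ} (hm : ∀ n, Measurable (Z n))
    (h0 : ∀ n ω, 0 ≤ Z n ω) (hind : iIndepFun Z P) (hid : ∀ n, IdentDistrib (Z n) (Z 0) P P)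
    (hni : ¬ Integrable (Z 0) P) :
    ∀ᵐ ω ∂P, Tendsto (fun N : ℕ => (∑ m ∈ Finset.range N, Z m ω) / N) atTop atTop := by
  have hmin (k : ℕ) : Measurable fun x : ℝ => min x k := by fun_prop
  have hi (k : ℕ) : Integrable (fun ω => min (Z 0 ω) k) P := by
    refine Integrable.of_bound (C := k) ((hmin k).comp (hm 0)).aestronglyMeasurable
      (ae_of_all _ fun ω => ?_)
    rw [Real.norm_of_nonneg (le_min (h0 _ _) (Nat.cast_nonneg _))]
    exact min_le_right _ _
  -- Truncated averages converge for all levels `k` at once and bound the full averages from below.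
  have hslln : ∀ᵐ ω ∂P, ∀ k : ℕ, Tendsto
      (fun N : ℕ => (∑ m ∈ Finset.range N, min (Z m ω) k) / N) atTop
      (𝓝 (∫ ω, min (Z 0 ω) k ∂P)) := by
    refine ae_all_iff.2 fun k => strong_law_ae_real (fun m ω => min (Z m ω) k) (hi k) ?_ ?_
    · intro i j hij
      exact (hind.indepFun hij).comp (hmin k) (hmin k)
    · exact fun i => (hid i).comp (hmin k)
  -- Bounded truncated means would make `Z 0` integrable by Fatou.
  have hunb : ∀ M : ℝ, ∃ k : ℕ, M < ∫ ω, min (Z 0 ω) k ∂P := by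
    by_contra! hcon
    obtain ⟨M, hM⟩ := hcon
    have hlim (ω : Ω) : Tendsto (fun k : ℕ => min (Z 0 ω) k) atTop (𝓝 (Z 0 ω)) := by
      refine tendsto_const_nhds.congr' ?_
      obtain ⟨k, hk⟩ := exists_nat_ge (Z 0 ω)
      filter_upwards [eventually_ge_atTop k] with n hn
      rw [min_eq_left (hk.trans (by exact_mod_cast hn))]
    have hfatou : ∫⁻ ω, ‖Z 0 ω‖ₑ ∂P ≤ liminf (fun k : ℕ => ∫⁻ ω, ‖min (Z 0 ω) k‖ₑ ∂P) atTop :=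
      (lintegral_congr fun ω => (hlim ω).enorm.liminf_eq.symm).trans_le
        (lintegral_liminf_le fun k => ((hmin k).comp (hm 0)).enorm)
    refine hni ⟨(hm 0).aestronglyMeasurable, hfatou.trans_lt (lt_top_iff_ne_top.2 ?_)⟩
    refine ne_top_of_le_ne_top (ENNReal.ofReal_ne_top (r := M))
      (liminf_le_of_le (by isBoundedDefault) fun b hb => ?_)
    obtain ⟨k, hk⟩ := hb.exists
    refine hk.trans ?_
    rw [← ofReal_integral_norm_eq_lintegral_enorm (hi k)]
    refine ENNReal.ofReal_le_ofReal (le_of_eq_of_le (integral_congr_ae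
      (ae_of_all _ fun ω => ?_)) (hM k))
    exact Real.norm_of_nonneg (le_min (h0 _ _) (Nat.cast_nonneg _))
  filter_upwards [hslln] with ω hω
  refine tendsto_atTop.2 fun M => ?_
  obtain ⟨k, hk⟩ := hunb M
  filter_upwards [(hω k).eventually_const_lt hk] with N hN
  refine hN.le.trans ?_
  gcongr
  exact min_le_left _ _

end IID

/-! ### Sums controlled by averages of `p`-th powers. -/

theorem sum_le_sum_rpow_rpow_inv {p : ℝ} (hp : 0 < p) (hp1 : p ≤ 1) {z : ℕ → ℝ}
    (hz : ∀ n, 0 ≤ z n) (N : ℕ) :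
    ∑ n ∈ Finset.range N, z n ≤ (∑ n ∈ Finset.range N, z n ^ p) ^ p⁻¹ := by
  rw [Real.le_rpow_inv_iff_of_pos (Finset.sum_nonneg fun n _ => hz n)
    (Finset.sum_nonneg fun n _ => Real.rpow_nonneg (hz n) p) hp]
  exact Finset.le_sum_of_subadditive_on_pred (fun x : ℝ => x ^ p) (fun x => 0 ≤ x)
    (Real.zero_rpow hp.ne').le (fun x y hx hy => Real.rpow_add_le_add_rpow hx hy hp.le hp1)
    (fun x y hx hy => add_nonneg hx hy) z fun n _ => hz n

/-- By subadditivity of `t ^ p`, the sum of the `z n` is `O(N ^ p⁻¹)`, which `S` outgrows. -/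
theorem tendsto_sum_div_zero_of_tendsto_average_rpow {p : ℝ} (hp : 0 < p) (hp1 : p ≤ 1)
    {z S : ℕ → ℝ} (hz : ∀ n, 0 ≤ z n) {L : ℝ}
    (hL : Tendsto (fun N : ℕ => (∑ n ∈ Finset.range N, z n ^ p) / N) atTop (𝓝 L))
    (hS : Tendsto (fun N : ℕ => S N / (N : ℝ) ^ p⁻¹) atTop atTop) :
    Tendsto (fun N : ℕ => (∑ n ∈ Finset.range N, z n) / S N) atTop (𝓝 0) := by
  have h1 := (hL.rpow_const (Or.inr (inv_pos.2 hp).le)).mul hS.inv_tendsto_atTop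
  rw [mul_zero] at h1
  have hpos := hS.eventually_gt_atTop 0
  refine tendsto_of_tendsto_of_tendsto_of_le_of_le' tendsto_const_nhds h1 ?_ ?_
  · filter_upwards [hpos, eventually_gt_atTop 0] with N hN hN0
    have hN0' : (0 : ℝ) < N := by exact_mod_cast hN0
    have : 0 < S N := (div_pos_iff_of_pos_right (by positivity)).1 hN
    exact div_nonneg (Finset.sum_nonneg fun n _ => hz n) this.le
  · filter_upwards [hpos, eventually_gt_atTop 0] with N hN hN0
    have hN0' : (0 : ℝ) < N := by exact_mod_cast hN0
    have hSN : 0 < S N := (div_pos_iff_of_pos_right (by positivity)).1 hN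
    have hs : 0 ≤ ∑ n ∈ Finset.range N, z n ^ p :=
      Finset.sum_nonneg fun n _ => Real.rpow_nonneg (hz n) p
    simp only [Pi.inv_apply]
    rw [inv_div, Real.div_rpow hs hN0'.le, div_mul_div_cancel₀ (by positivity)]
    gcongr
    exact sum_le_sum_rpow_rpow_inv hp hp1 hz N

theorem sum_range_sum_range_mul_add {M : Type*} [AddCommMonoid M] (f : ℕ → M) (τ N : ℕ) :
    ∑ n ∈ Finset.range N, ∑ i ∈ Finset.range τ, f (τ * n + i) = ∑ m ∈ Finset.range (τ * N), f m := by
  induction N with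
  | zero => simp
  | succ N ih => rw [Finset.sum_range_succ, ih, mul_add_one, Finset.sum_range_add]

/-! ### Negligibility of the mixed terms over blocks. -/

section IID

variable {Ω : Type*} [MeasurableSpace Ω] {P : Measure Ω} [IsProbabilityMeasure P] {Y : ℕ → Ω → ℝ}

/-- Within a block, independence factors the `p`-th moment of the product. Different blocks use
disjoint indices, so the products are pairwise independent, which is all the strong law asks. -/
theorem ae_tendsto_average_mixed (hm : ∀ n, Measurable (Y n)) (hind : iIndepFun Y P)
    (hid : ∀ n, IdentDistrib (Y n) (Y 0) P P) {a b p : ℝ}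
    (hia : Integrable (fun ω => |Y 0 ω| ^ (a * p)) P)
    (hib : Integrable (fun ω => |Y 0 ω| ^ (b * p)) P) {τ i j : ℕ} (hi : i < τ) (hj : j < τ)
    (hij : i ≠ j) :
    ∀ᵐ ω ∂P, ∃ L, Tendsto (fun N : ℕ => (∑ n ∈ Finset.range N,
      (|Y (τ * n + i) ω| ^ a * |Y (τ * n + j) ω| ^ b) ^ p) / N) atTop (𝓝 L) := by
  set g : ℝ × ℝ → ℝ := fun x => (|x.1| ^ a * |x.2| ^ b) ^ p with hg
  have hgm : Measurable g := by fun_prop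
  have hpow (c : ℝ) : Measurable fun x : ℝ => |x| ^ (c * p) := by fun_prop
  have hne : ∀ m n k l : ℕ, k < τ → l < τ → m ≠ n → τ * m + k ≠ τ * n + l := by
    intro m n k l hk hl hmn h
    have h1 := congrArg (· / τ) h
    simp only [Nat.mul_add_div (Nat.zero_lt_of_lt hk), Nat.div_eq_of_lt hk,
      Nat.div_eq_of_lt hl, add_zero] at h1
    exact hmn h1
  have hid' (m n : ℕ) : IdentDistrib (Y m) (Y n) P P := (hid m).trans (hid n).symm
  have hia' : Integrable (fun ω => |Y (τ * 0 + i) ω| ^ (a * p)) P :=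
    ((hid (τ * 0 + i)).comp (hpow a)).integrable_iff.2 hia
  have hib' : Integrable (fun ω => |Y (τ * 0 + j) ω| ^ (b * p)) P :=
    ((hid (τ * 0 + j)).comp (hpow b)).integrable_iff.2 hib
  have hindij (n : ℕ) : IndepFun (Y (τ * n + i)) (Y (τ * n + j)) P :=
    hind.indepFun (by omega)
  have hint : Integrable (fun ω => g (Y (τ * 0 + i) ω, Y (τ * 0 + j) ω)) P := by
    refine (((hindij 0).comp (hpow a) (hpow b)).integrable_mul hia' hib').congr
      (ae_of_all _ fun ω => ?_)
    simp only [hg, Pi.mul_apply, Function.comp]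
    rw [Real.mul_rpow (by positivity) (by positivity), Real.rpow_mul (abs_nonneg _),
      Real.rpow_mul (abs_nonneg _)]
  have := strong_law_ae_real (fun n ω => g (Y (τ * n + i) ω, Y (τ * n + j) ω)) hint
    (fun m n hmn => (hind.indepFun_prodMk_prodMk hm _ _ _ _ (hne m n i i hi hi hmn)
      (hne m n i j hi hj hmn) (hne m n j i hj hi hmn) (hne m n j j hj hj hmn)).comp hgm hgm)
    (fun n => ((hid' _ _).prodMk (hid' _ _) (hindij n) (hindij 0)).comp hgm)
  filter_upwards [this] with ω hω
  exact ⟨_, hω⟩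

/-- For i.i.d. variables for which the sum of the `q`-th powers of the moduli grows faster than
`N ^ p⁻¹` while the mixed terms of order `q` have a finite `p`-th moment, summing over blocks of
length `τ` before or after taking `q`-th powers is asymptotically the same. -/
theorem ae_tendsto_block_sum_ratio (hm : ∀ n, Measurable (Y n)) (hind : iIndepFun Y P)
    (hid : ∀ n, IdentDistrib (Y n) (Y 0) P P) {q a b p C : ℝ} {τ : ℕ} (hτ : 1 ≤ τ)
    (hp : 0 < p) (hp1 : p ≤ 1)
    (hC : ∀ y : ℕ → ℝ,
      |(|∑ i ∈ Finset.range τ, y i| ^ q - ∑ i ∈ Finset.range τ, |y i| ^ q)| ≤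
        C * ∑ j ∈ Finset.range τ, ∑ i ∈ Finset.range j,
          (|y i| ^ a * |y j| ^ b + |y i| ^ b * |y j| ^ a))
    (hia : Integrable (fun ω => |Y 0 ω| ^ (a * p)) P)
    (hib : Integrable (fun ω => |Y 0 ω| ^ (b * p)) P)
    (hS : ∀ᵐ ω ∂P, Tendsto (fun N : ℕ => (∑ m ∈ Finset.range N, |Y m ω| ^ q) / (N : ℝ) ^ p⁻¹)
      atTop atTop) :
    ∀ᵐ ω ∂P, Tendsto (fun N : ℕ =>
      (∑ n ∈ Finset.range N, |∑ i ∈ Finset.range τ, Y (τ * n + i) ω| ^ q) /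
        ∑ n ∈ Finset.range N, ∑ i ∈ Finset.range τ, |Y (τ * n + i) ω| ^ q) atTop (𝓝 1) := by
  have hmix : ∀ᵐ ω ∂P, ∀ i j, i < j → j < τ →
      (∃ L, Tendsto (fun N : ℕ => (∑ n ∈ Finset.range N,
        (|Y (τ * n + i) ω| ^ a * |Y (τ * n + j) ω| ^ b) ^ p) / N) atTop (𝓝 L)) ∧
      ∃ L, Tendsto (fun N : ℕ => (∑ n ∈ Finset.range N,
        (|Y (τ * n + i) ω| ^ b * |Y (τ * n + j) ω| ^ a) ^ p) / N) atTop (𝓝 L) := by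
    simp only [ae_all_iff]
    intro i j hij hj
    exact (ae_tendsto_average_mixed hm hind hid hia hib (hij.trans hj) hj hij.ne).and
      (ae_tendsto_average_mixed hm hind hid hib hia (hij.trans hj) hj hij.ne)
  filter_upwards [hmix, hS] with ω hω hSω
  set S : ℕ → ℝ := fun N => ∑ n ∈ Finset.range N, ∑ i ∈ Finset.range τ, |Y (τ * n + i) ω| ^ q
    with hSdef
  -- `S N` runs over the first `τ * N ≥ N` variables, so it inherits the growth of the sum over the
  -- first `N`.
  have hSlim : Tendsto (fun N : ℕ => S N / (N : ℝ) ^ p⁻¹) atTop atTop := by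
    refine tendsto_atTop_mono (fun N => ?_) hSω
    gcongr
    rw [hSdef]
    simp only
    rw [sum_range_sum_range_mul_add (fun m => |Y m ω| ^ q) τ N]
    exact Finset.sum_le_sum_of_subset_of_nonneg
      (Finset.range_subset_range.2 (Nat.le_mul_of_pos_left N hτ)) fun _ _ _ => by positivity
  have hSpos : ∀ᶠ N in atTop, 0 < S N := by
    filter_upwards [hSlim.eventually_gt_atTop 0, eventually_gt_atTop 0] with N hN hN0
    have hN0' : (0 : ℝ) < N := by exact_mod_cast hN0
    exact (div_pos_iff_of_pos_right (by positivity)).1 hN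
  have herr : Tendsto (fun N : ℕ => C * ∑ j ∈ Finset.range τ, ∑ i ∈ Finset.range j,
      ((∑ n ∈ Finset.range N, |Y (τ * n + i) ω| ^ a * |Y (τ * n + j) ω| ^ b) / S N +
       (∑ n ∈ Finset.range N, |Y (τ * n + i) ω| ^ b * |Y (τ * n + j) ω| ^ a) / S N))
      atTop (𝓝 0) := by
    have : Tendsto (fun N : ℕ => C * ∑ j ∈ Finset.range τ, ∑ i ∈ Finset.range j,
      ((∑ n ∈ Finset.range N, |Y (τ * n + i) ω| ^ a * |Y (τ * n + j) ω| ^ b) / S N +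
       (∑ n ∈ Finset.range N, |Y (τ * n + i) ω| ^ b * |Y (τ * n + j) ω| ^ a) / S N))
      atTop (𝓝 (C * ∑ j ∈ Finset.range τ, ∑ i ∈ Finset.range j, ((0 : ℝ) + 0))) := by
      refine (tendsto_finsetSum _ fun j hj => tendsto_finsetSum _ fun i hi => ?_).const_mul C
      obtain ⟨⟨L, hL⟩, L', hL'⟩ := hω i j (Finset.mem_range.1 hi) (Finset.mem_range.1 hj)
      exact (tendsto_sum_div_zero_of_tendsto_average_rpow hp hp1 (fun n => by positivity) hL
        hSlim).add (tendsto_sum_div_zero_of_tendsto_average_rpow hp hp1 (fun n => by positivity)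
          hL' hSlim)
    simpa using this
  rw [tendsto_iff_dist_tendsto_zero]
  refine tendsto_of_tendsto_of_tendsto_of_le_of_le' tendsto_const_nhds herr
    (Eventually.of_forall fun N => dist_nonneg) ?_
  filter_upwards [hSpos] with N hN
  rw [Real.dist_eq, div_sub_one hN.ne', abs_div, abs_of_pos hN, div_le_iff₀ hN, hSdef]
  simp only
  rw [← Finset.sum_sub_distrib]
  refine (Finset.abs_sum_le_sum_abs _ _).trans
    ((Finset.sum_le_sum fun n _ => hC fun i => Y (τ * n + i) ω).trans (le_of_eq ?_))
  rw [← Finset.mul_sum, mul_assoc, Finset.sum_comm, Finset.sum_mul]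
  congr 1
  refine Finset.sum_congr rfl fun j _ => ?_
  rw [Finset.sum_comm, Finset.sum_mul]
  refine Finset.sum_congr rfl fun i _ => ?_
  rw [Finset.sum_add_distrib, add_mul, div_mul_cancel₀ _ hN.ne', div_mul_cancel₀ _ hN.ne']

end IID

/-! ### Application to the stable process. -/

theorem proposition2 {Ω : Type*} [MeasurableSpace Ω] (P : Measure Ω) [IsProbabilityMeasure P]
    (X : ℝ≥0 → Ω → ℝ) (α : ℝ) (hα : α < 2) (hX : IsSelfSimilarLevyProcess X P α)
    (q : ℝ) (hq : α ≤ q) (τ : ℕ) (hτ : 1 ≤ τ) :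
    ∀ᵐ ω ∂P, Tendsto
      (fun N : ℕ =>
        (∑ n ∈ Finset.range N, |increment X ((τ : ℝ≥0) * n) τ ω| ^ q) /
          ∑ n ∈ Finset.range N, ∑ i ∈ Finset.range τ,
            |increment X ((τ : ℝ≥0) * n + i) 1 ω| ^ q)
      atTop (𝓝 1) := by
  obtain ⟨σ, γ, hσ, -, hchar⟩ := hX.strictlyStable
  have hα0 := hX.index_pos
  have hq0 : 0 < q := hα0.trans_le hq
  set Y : ℕ → Ω → ℝ := fun m => increment X m 1 with hY
  have hm : ∀ n, Measurable (Y n) := fun n => (hX.measurable _).sub (hX.measurable _)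
  have hind : iIndepFun Y P := by
    have := hX.indep.nat (t := fun n : ℕ => (n : ℝ≥0)) Nat.mono_cast
    simp only [Nat.cast_add, Nat.cast_one] at this
    exact this
  have hid : ∀ n, IdentDistrib (Y n) (Y 0) P P := fun n =>
    (hX.stationary n 1).trans (by simpa [hY] using (hX.stationary 0 1).symm)
  set μ := P.map (Y 0) with hμ
  have hμP : IsProbabilityMeasure μ := Measure.isProbabilityMeasure_map (hm 0).aemeasurable
  have hcharμ : ∀ k, charFun μ k = Complex.exp (-stableExponent α σ γ k) := by
    intro k
    have h1 : μ = P.map (X 1) := by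
      refine Measure.map_congr ?_
      filter_upwards [hX.zero] with ω hω
      simp [hY, increment, hω]
    rw [h1, hchar]
    simp
  obtain ⟨K, c, hc, hK, hL⟩ := exists_charFun_bounds_of_stableExponent hσ hα0 hcharμ
  obtain ⟨d, η, hd, -, htail⟩ := exists_le_measureReal_abs_gt_of_charFun hα0 hα hc hK hL
  have hmom : ∀ s, 0 < s → s < α → Integrable (fun ω => |Y 0 ω| ^ s) P := fun s hs hsα =>
    (integrable_abs_rpow_of_tail hs hsα fun r hr =>
      measureReal_abs_gt_le_of_charFun hα0.le hK hr).comp_measurable (hm 0)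
  obtain ⟨a, b, ha, hb, hab, hCex⟩ := exists_abs_sum_rpow_sub_le hq0
  obtain ⟨C, -, hC⟩ := hCex τ
  obtain ⟨p, hp, hp1, hap, hbp, hS⟩ : ∃ p : ℝ, 0 < p ∧ p ≤ 1 ∧ a * p < α ∧ b * p < α ∧
      ∀ᵐ ω ∂P, Tendsto (fun N : ℕ => (∑ m ∈ Finset.range N, |Y m ω| ^ q) / (N : ℝ) ^ p⁻¹)
        atTop atTop := by
    rcases hq.eq_or_lt with h | h
    -- Critical case `q = α`: `a, b < α` makes mixed terms integrable, while the `q`-th moment is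
    -- infinite.
    · refine ⟨1, one_pos, le_rfl, by linarith, by linarith, ?_⟩
      simp only [inv_one, Real.rpow_one]
      have hpow : Measurable fun x : ℝ => |x| ^ q := by fun_prop
      refine ae_tendsto_average_atTop_of_not_integrable (Z := fun m ω => |Y m ω| ^ q)
        (fun n => hpow.comp (hm n)) (fun n ω => by positivity)
        (hind.comp (fun _ x => |x| ^ q) fun _ => hpow) (fun n => (hid n).comp hpow) fun hi => ?_
      refine not_integrable_abs_rpow_of_le_tail (μ := μ) hα0 hd htail ?_
      rw [h, hμ, integrable_map_measure hpow.aestronglyMeasurable (hm 0).aemeasurable]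
      exact hi
    -- A `p` in this gap has `p⁻¹ < q / α` for the growth and `a * p, b * p < α` for the moments;
    -- the gap is nonempty as `q > α` and `a, b < q`.
    · have hlt : α / q < min 1 (min (α / a) (α / b)) := by
        refine lt_min ((div_lt_one hq0).2 h) (lt_min ?_ ?_) <;>
          exact div_lt_div_of_pos_left hα0 (by assumption) (by linarith)
      obtain ⟨p, hp1, hp2⟩ := exists_between hlt
      obtain ⟨hp3, hp4⟩ := lt_min_iff.1 hp2
      obtain ⟨hp5, hp6⟩ := lt_min_iff.1 hp4
      have hp0 : 0 < p := (by positivity : 0 < α / q).trans hp1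
      refine ⟨p, hp0, hp3.le, by rwa [mul_comm, ← lt_div_iff₀ ha],
        by rwa [mul_comm, ← lt_div_iff₀ hb], ?_⟩
      refine ae_tendsto_sum_div_rpow_atTop hm hind hid hα0 hd htail hq0 (by positivity) ?_
      rw [← inv_div α q]
      exact inv_strictAnti₀ (by positivity) hp1
  filter_upwards [ae_tendsto_block_sum_ratio hm hind hid hτ hp hp1 hC
    (hmom _ (by positivity) hap) (hmom _ (by positivity) hbp) hS] with ω hω
  have htel (n : ℕ) : increment X ((τ : ℝ≥0) * n) τ ω =
      ∑ i ∈ Finset.range τ, Y (τ * n + i) ω := by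
    have := Finset.sum_range_sub (fun i : ℕ => X ((τ * n + i : ℕ) : ℝ≥0) ω) τ
    simp only [Nat.cast_add, Nat.cast_mul, add_zero, Nat.cast_one,
      ← add_assoc] at this
    simp only [hY, increment, Nat.cast_add, Nat.cast_mul]
    exact this.symm
  simp only [htel]
  simpa only [hY, Nat.cast_add, Nat.cast_mul] using hω
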